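/- Let $\mathcal X\subset\mathbb R^n$ be a bounded open set, and let $\mathcal H$ be a reproducing kernel Hilbert space of real functions on $\bar{\mathcal X}$ with reproducing kernel $K$. For $x\in\bar{\mathcal X}$ let $K_x\in\mathcal H$ denote the element with $f(x)=\langle K_x,f\rangle_{\mathcal H}$ for all $f\in\mathcal H$, so that $K(x,y)=\langle K_x,K_y\rangle_{\mathcal H}$, and let $\Phi_K:x\mapsto K_x$ be the feature map. Assume that - $K\in C^2(\bar{\mathcal X}\times\bar{\mathcal X})$, i.e. $K$ is continuous on $\bar{\mathcal X}\times\bar{\mathcal X}$, twice continuously differentiable on $\mathcal X\times\mathcal X$, and its derivatives of order at most $2$ extend continuously to $\bar{\mathcal X}\times\bar{\mathcal X}$; - $\Phi_K$ is injective on $\bar{\mathcal X}$; - for every $x\in\mathcal X$ the derivative Gram matrix $G(x)=\big[\partial^{(e_i,e_j)}K(x,x)\big]_{i,j=1}^n$ is positive definite, where $\partial^{(e_i,e_j)}K$ is the partial derivative of $K$ in the $i$-th coordinate of its first argument and the $j$-th coordinate of its second argument. Then $\Phi_K$ is of class $C^1$ on $\mathcal X$, $D\Phi_K(x)^*D\Phi_K(x)=G(x)$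 for every $x\in\mathcal X$, and $\Phi_K$ restricted to $\mathcal X$ is a $C^1$ embedding of $\mathcal X$ into $\mathcal H$, that is, a $C^1$ immersion which is a homeomorphism onto its image $\mathcal X'=\Phi_K(\mathcal X)$. Hence, for every $m$ and every $C^1$ function $F:\mathcal X\to\mathbb R^m$, the function $F'=F\circ(\Phi_K|_{\mathcal X})^{-1}:\mathcal X'\to\mathbb R^m$ satisfies $F'\circ\Phi_K=F$ on $\mathcal X$, it is a $C^1$ function on the submanifold $\mathcal X'$ (near each point of $\mathcal X'$ it is the restriction of a $C^1$ function defined on an open subset of $\mathcal H$), and for every $x\in\mathcal X$ and $\xi\in\mathbb R^m$ $$\nabla(\xi^TF')(K_x)=D\Phi_K(x)\,G(x)^{-1}\,\nabla(\xi^TF)(x)\in\mathcal H .$$ Here the gradient on the left is the gradient on the submanifold $\mathcal X'$ with the inner product induced from $\mathcal H$: the unique vector $g$ tangent to $\mathcal X'$ at $K_x$ such that $\frac{d}{dt}\big|_{t=0}\,\xi^TF'(\gamma(t))=\langle g,\gamma'(0)\rangle_{\mathcal H}$ for every $C^1$ curve $\gamma$ in $\mathcal X'$ with $\gamma(0)=K_x$.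 -/

import Mathlib

open Set Topology
open scoped Manifold

noncomputable section

/-- `f` is of class `C^k` on the closure of the open set `Ω`: it is continuous on `closure Ω`, of
class `C^k` on `Ω`, and each of its derivatives of order at most `k` on `Ω` extends continuously
to `closure Ω`. -/
def ContDiffUpToBoundary {V W : Type*} [NormedAddCommGroup V] [NormedSpace ℝ V]
    [NormedAddCommGroup W] [NormedSpace ℝ W] (k : ℕ) (f : V → W) (Ω : Set V) : Prop :=
  ContinuousOn f (closure Ω) ∧ ContDiffOn ℝ k f Ω ∧
    ∀ j ≤ k, ∃ g : V → ContinuousMultilinearMap ℝ (fun _ : Fin j => V) W,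
      ContinuousOn g (closure Ω) ∧ EqOn g (iteratedFDeriv ℝ j f) Ω

/-- The feature map `x ↦ K_x` of an RKHS of real functions on the set `S`, where `K_x` represents
evaluation at `x`. It is extended by zero outside `S`, so that it can be differentiated at the
interior points of `S`. -/
def featureMap {E : Type*} (S : Set E) (H : Type*) [NormedAddCommGroup H] [InnerProductSpace ℝ H]
    [CompleteSpace H] [RKHS ℝ H S ℝ] (x : E) : H :=
  open Classical in if hx : x ∈ S then RKHS.kerFun H (⟨x, hx⟩ : S) (1 : ℝ) else 0

/-- The matrix with entries `∂^{(e_i, e_j)} K (x, x)`: the partial derivative of `K` in the `i`-th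
coordinate of the first argument and the `j`-th coordinate of the second one, at `(x, x)`. -/
def derivGram {n : ℕ} (K : EuclideanSpace ℝ (Fin n) × EuclideanSpace ℝ (Fin n) → ℝ)
    (x : EuclideanSpace ℝ (Fin n)) : Matrix (Fin n) (Fin n) ℝ :=
  Matrix.of fun i j =>
    fderiv ℝ (fun x' => fderiv ℝ (fun y' => K (x', y')) x (EuclideanSpace.single j 1)) x
      (EuclideanSpace.single i 1)

/-- `f` is a `C^1` function on the (submanifold) `S`: near each point of `S` it is the restriction
to `S` of a `C^1` function on an open set of the ambient space. Only the values of `f` on `S`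
matter. -/
def IsC1OnSubmanifold {H V : Type*} [NormedAddCommGroup H] [NormedSpace ℝ H]
    [NormedAddCommGroup V] [NormedSpace ℝ V] (f : H → V) (S : Set H) : Prop :=
  ∀ p ∈ S, ∃ U : Set H, IsOpen U ∧ p ∈ U ∧ ∃ g : H → V, ContDiffOn ℝ 1 g U ∧ EqOn g f (S ∩ U)

/-- `γ` is a `C^1` curve (defined near `0`) in `S` with `γ 0 = p`. -/
structure IsC1CurveIn {H : Type*} [NormedAddCommGroup H] [NormedSpace ℝ H]
    (γ : ℝ → H) (S : Set H) (p : H) : Prop where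
  contDiffAt : ContDiffAt ℝ 1 γ 0
  mem : ∀ᶠ t in 𝓝 (0 : ℝ), γ t ∈ S
  base : γ 0 = p

/-- The vectors tangent to `S` at `p`: the velocities of the `C^1` curves in `S` through `p`. -/
def tangentVectors {H : Type*} [NormedAddCommGroup H] [NormedSpace ℝ H]
    (S : Set H) (p : H) : Set H :=
  {v | ∃ γ : ℝ → H, IsC1CurveIn γ S p ∧ deriv γ 0 = v}

/-- `g` is the gradient at `p` of the function `f` on the submanifold `S`, for the inner product
induced by the ambient Hilbert space: `g` is tangent to `S` at `p`, and the derivative of `f` along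
each `C^1` curve in `S` through `p` is the inner product of `g` with the velocity. -/
structure HasGradientOnSubmanifold {H : Type*} [NormedAddCommGroup H] [InnerProductSpace ℝ H]
    (f : H → ℝ) (S : Set H) (p g : H) : Prop where
  tangent : g ∈ tangentVectors S p
  hasDerivAt : ∀ γ : ℝ → H, IsC1CurveIn γ S p →
    HasDerivAt (fun t => f (γ t)) (inner ℝ g (deriv γ 0)) 0

/-- The gradient on a submanifold is unique. -/
theorem HasGradientOnSubmanifold.unique {H : Type*} [NormedAddCommGroup H]
    [InnerProductSpace ℝ H] {f : H → ℝ} {S : Set H} {p g g' : H}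
    (h : HasGradientOnSubmanifold f S p g) (h' : HasGradientOnSubmanifold f S p g') :
    g = g' := by
  have key : ∀ v ∈ tangentVectors S p, inner ℝ g v = inner ℝ g' v := by
    rintro v ⟨γ, hγ, rfl⟩
    exact (h.hasDerivAt γ hγ).unique (h'.hasDerivAt γ hγ)
  rw [← sub_eq_zero, ← inner_self_eq_zero (𝕜 := ℝ)]
  rw [inner_sub_left, inner_sub_right, inner_sub_right, key g h.tangent, key g' h'.tangent]
  ring

end

/-! Everything rests on the identity `⟨Φ x, Φ y⟩ = K (x, y)`, which turns norms of combinations of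
feature vectors into kernel values. The inner product of two increments of `Φ` is a mixed second
difference of `K`. Since `K` is `C^2`, near `(x, x)` it equals the mixed derivative `b`, up to `ε`
times the product of the increment lengths (`mixed_difference_estimate`). Hence difference quotients
are Cauchy in `H`, their limits form a bounded linear map `L` with `⟨L h, L k⟩ = b h k`, and
expanding `‖Φ y - Φ z - L (y - z)‖ ^ 2` shows that `L` is a strict derivative
(`HasIncrementGram.exists_hasStrictFDerivAt`). Strict differentiability on an open set gives `C^1`,
and in coordinates `b` is the matrix `G`.

Invertibility of `G = DΦ^* DΦ` makes `DΦ` injective. Its range is finite-dimensional, hence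
complemented, so the inverse function theorem gives the normal form of an immersion. The
homeomorphism onto the image comes from compactness of the closure. Both together give local `C^1`
retractions `r` with `r ∘ Φ = id` (`exists_contDiffOn_leftInverse`), so locally `F' = F ∘ r`. A
curve in the image is `Φ ∘ (r ∘ γ)`, and the gradient formula reduces to `DΦ^* DΦ (G⁻¹ ∇f) = ∇f`. -/

noncomputable section

open Filter Metric

/-! ### Strict differentiability from the Gram function of increments -/

section Calculus

variable {E V H : Type*} [NormedAddCommGroup E] [NormedSpace ℝ E]
  [NormedAddCommGroup V] [NormedSpace ℝ V]
  [NormedAddCommGroup H] [InnerProductSpace ℝ H]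

/-- The mixed second derivative of a function of two variables: first the derivative in the first
variable, then in the second one. -/
def mixedDeriv (K : E × E → ℝ) (x : E) : E →L[ℝ] E →L[ℝ] ℝ :=
  ((ContinuousLinearMap.compL ℝ E (E × E) ℝ).flip (ContinuousLinearMap.inr ℝ E E)) ∘L
    (fderiv ℝ (fderiv ℝ K) (x, x)) ∘L (ContinuousLinearMap.inl ℝ E E)

theorem mixedDeriv_apply (K : E × E → ℝ) (x h k : E) :
    mixedDeriv K x h k = fderiv ℝ (fderiv ℝ K) (x, x) (h, 0) (0, k) := rfl

/-- The inner products of the increments of `Φ` near `x` are given by `b`, to first order in each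
increment. -/
def HasIncrementGram (Φ : E → H) (b : E →L[ℝ] E →L[ℝ] ℝ) (x : E) : Prop :=
  ∀ ε > 0, ∃ δ > 0, ∀ y ∈ ball x δ, ∀ z ∈ ball x δ, ∀ y' ∈ ball x δ, ∀ z' ∈ ball x δ,
    |inner ℝ (Φ y - Φ z) (Φ y' - Φ z') - b (y - z) (y' - z')| ≤ ε * ‖y - z‖ * ‖y' - z'‖

/-- The mixed second difference of a `C^2` function is given by the mixed derivative, to first
order in each increment. -/
theorem mixed_difference_estimate {K : E × E → ℝ} {x : E} (hK : ContDiffAt ℝ 2 K (x, x))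
    {ε : ℝ} (hε : 0 < ε) :
    ∃ δ > 0, ∀ y ∈ ball x δ, ∀ z ∈ ball x δ, ∀ y' ∈ ball x δ, ∀ z' ∈ ball x δ,
      |K (y, y') - K (z, y') - (K (y, z') - K (z, z')) - mixedDeriv K x (y - z) (y' - z')|
        ≤ ε * ‖y - z‖ * ‖y' - z'‖ := by
  have h1 : ContDiffAt ℝ 1 (fderiv ℝ K) (x, x) := hK.fderiv_right (by norm_num)
  have h2 := (hasStrictFDerivAt_iff_isLittleO.1 (h1.hasStrictFDerivAt one_ne_zero)).def hε
  have h3 : ∀ᶠ p in 𝓝 (x, x), DifferentiableAt ℝ K p :=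
    (hK.eventually (by simp)).mono fun p hp => hp.differentiableAt (by norm_num)
  obtain ⟨δ₁, hδ₁, h2⟩ := Metric.eventually_nhds_iff_ball.1 h2
  obtain ⟨δ₂, hδ₂, h3⟩ := Metric.eventually_nhds_iff_ball.1 h3
  have hpair : ∀ {δ : ℝ} {y z : E}, y ∈ ball x δ → z ∈ ball x δ → (y, z) ∈ ball (x, x) δ := by
    intro δ y z hy hz
    rw [← ball_prod_same]; exact ⟨hy, hz⟩
  refine ⟨min δ₁ δ₂, lt_min hδ₁ hδ₂, fun y hy z hz y' hy' z' hz' => ?_⟩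
  have m1 := ball_subset_ball (x := x) (min_le_left δ₁ δ₂)
  have m2 := ball_subset_ball (x := x) (min_le_right δ₁ δ₂)
  have hd : ∀ a ∈ ball x (min δ₁ δ₂), ∀ w ∈ ball x (min δ₁ δ₂),
      HasFDerivAt (fun w => K (a, w)) (fderiv ℝ K (a, w) ∘L ContinuousLinearMap.inr ℝ E E) w :=
    fun a ha w hw => (h3 _ (hpair (m2 ha) (m2 hw))).hasFDerivAt.comp w (hasFDerivAt_prodMk_right a w)
  -- Mean value inequality in the second variable only. The derivative is controlled by strict
  -- differentiability of `fderiv ℝ K` at `(x, x)`, applied to `(y, w)` and `(z, w)`, whose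
  -- difference is `(y - z, 0)`.
  have hmv := (convex_ball x (min δ₁ δ₂)).norm_image_sub_le_of_norm_hasFDerivWithin_le
    (f := fun w => K (y, w) - K (z, w) - mixedDeriv K x (y - z) w) (C := ε * ‖y - z‖)
    (fun w hw => (((hd y hy w hw).sub (hd z hz w hw)).sub
      (mixedDeriv K x (y - z)).hasFDerivAt).hasFDerivWithinAt) (fun w hw => ?_) hz' hy'
  · rw [Real.norm_eq_abs] at hmv
    refine le_trans (le_of_eq ?_) hmv
    rw [map_sub (mixedDeriv K x (y - z))]
    congr 1; ring
  · have hb := h2 ((y, w), (z, w)) (by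
      rw [← ball_prod_same]; exact ⟨hpair (m1 hy) (m1 hw), hpair (m1 hz) (m1 hw)⟩)
    simp only [Prod.mk_sub_mk, sub_self] at hb
    have hn : ‖((y - z, 0) : E × E)‖ = ‖y - z‖ := by simp [Prod.norm_def]
    rw [hn] at hb
    calc _ = ‖(fderiv ℝ K (y, w) - fderiv ℝ K (z, w) - fderiv ℝ (fderiv ℝ K) (x, x) (y - z, 0)) ∘L
          ContinuousLinearMap.inr ℝ E E‖ := by
            congr 1
      _ ≤ _ * ‖ContinuousLinearMap.inr ℝ E E‖ := ContinuousLinearMap.opNorm_comp_le _ _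
      _ ≤ (ε * ‖y - z‖) * 1 := by
            gcongr
            exact ContinuousLinearMap.norm_inr_le_one ℝ E E
      _ = _ := mul_one _

/-- A map whose Gram function is a bounded bilinear form is a bounded linear map. -/
theorem exists_clm_of_inner_eq (v : E → H) (b : E →L[ℝ] E →L[ℝ] ℝ)
    (hv : ∀ h k, inner ℝ (v h) (v k) = b h k) :
    ∃ L : E →L[ℝ] H, ⇑L = v := by
  have hadd : ∀ h k, v (h + k) = v h + v k := fun h k => by
    rw [← sub_eq_zero, ← inner_self_eq_zero (𝕜 := ℝ)]
    simp only [inner_sub_left, inner_sub_right, inner_add_left, inner_add_right, hv, map_add,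
      add_apply]
    ring
  have hsmul : ∀ (c : ℝ) h, v (c • h) = c • v h := fun c h => by
    rw [← sub_eq_zero, ← inner_self_eq_zero (𝕜 := ℝ)]
    simp only [inner_sub_left, inner_sub_right, inner_smul_left, inner_smul_right, hv, map_smul,
      smul_apply, smul_eq_mul, conj_trivial]
    ring
  refine ⟨LinearMap.mkContinuous ⟨⟨v, hadd⟩, hsmul⟩ (√‖b‖) fun h => ?_, rfl⟩
  refine le_of_sq_le_sq ?_ (by positivity)
  change ‖v h‖ ^ 2 ≤ _
  rw [mul_pow, Real.sq_sqrt (norm_nonneg b)]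
  rw [← real_inner_self_eq_norm_sq, hv]
  calc b h h ≤ ‖b h h‖ := Real.le_norm_self _
    _ ≤ ‖b‖ * ‖h‖ * ‖h‖ := b.le_opNorm₂ h h
    _ = _ := by ring

section Derivative

variable {Φ : E → H} {b : E →L[ℝ] E →L[ℝ] ℝ} {x : E}

/-- The two step sizes tend to zero independently. The joint limit serves both the Cauchy property
of one slope and the inner products of two limiting slopes. -/
theorem HasIncrementGram.tendsto_inner_slope (hΦ : HasIncrementGram Φ b x) (h k : E) :
    Tendsto (fun p : ℝ × ℝ => inner ℝ (p.1⁻¹ • (Φ (x + p.1 • h) - Φ x))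
      (p.2⁻¹ • (Φ (x + p.2 • k) - Φ x))) (𝓝[≠] 0 ×ˢ 𝓝[≠] 0) (𝓝 (b h k)) := by
  rw [Metric.tendsto_nhds]
  intro ε hε
  -- The summands `+ 1` and the factor `2` keep the final inequality strict even when `h` or `k` is
  -- zero.
  obtain ⟨δ, hδ, hb⟩ := hΦ (ε / (2 * (‖h‖ + 1) * (‖k‖ + 1))) (by positivity)
  have hnear : ∀ e : E, ∀ᶠ t in 𝓝[≠] (0 : ℝ), t ≠ 0 ∧ x + t • e ∈ ball x δ := fun e => by
    refine eventually_mem_nhdsWithin.and (nhdsWithin_le_nhds ?_)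
    have : Continuous fun t : ℝ => x + t • e := by fun_prop
    exact this.continuousAt.eventually (isOpen_ball.mem_nhds (by simpa using hδ))
  filter_upwards [(hnear h).prod_mk (hnear k)] with ⟨t, s⟩ ⟨⟨ht, hth⟩, hs, hsk⟩
  have hx := mem_ball_self (x := x) hδ
  have := hb _ hth _ hx _ hsk _ hx
  simp only [add_sub_cancel_left, map_smul, smul_apply, smul_eq_mul, norm_smul] at this
  rw [Real.dist_eq, inner_smul_left, inner_smul_right, conj_trivial]
  dsimp only at ht hs ⊢
  have hts : 0 < |t| * |s| := by positivity
  rw [Real.norm_eq_abs, Real.norm_eq_abs] at this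
  have e1 : t⁻¹ * (s⁻¹ * inner ℝ (Φ (x + t • h) - Φ x) (Φ (x + s • k) - Φ x)) - b h k
      = (t * s)⁻¹ * (inner ℝ (Φ (x + t • h) - Φ x) (Φ (x + s • k) - Φ x) - s * (t * b h k)) := by
    field_simp
  rw [e1, abs_mul, abs_inv, abs_mul, inv_mul_lt_iff₀ hts]
  have hlt : ‖h‖ * ‖k‖ < 2 * (‖h‖ + 1) * (‖k‖ + 1) := by
    nlinarith [norm_nonneg h, norm_nonneg k, mul_nonneg (norm_nonneg h) (norm_nonneg k)]
  have h3 : ε / (2 * (‖h‖ + 1) * (‖k‖ + 1)) * (‖h‖ * ‖k‖) < ε := by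
    rw [div_mul_eq_mul_div, div_lt_iff₀ (by positivity)]
    exact mul_lt_mul_of_pos_left hlt hε
  calc _ ≤ ε / (2 * (‖h‖ + 1) * (‖k‖ + 1)) * (|t| * ‖h‖) * (|s| * ‖k‖) := by
        exact this
    _ = |t| * |s| * (ε / (2 * (‖h‖ + 1) * (‖k‖ + 1)) * (‖h‖ * ‖k‖)) := by ring
    _ < _ := mul_lt_mul_of_pos_left h3 hts

/-- Cauchy criterion: `‖u t - u s‖ ^ 2 = ⟨u t, u t⟩ - 2 ⟨u t, u s⟩ + ⟨u s, u s⟩`, and all three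
terms have limits built from the same number `b h h`, which cancel. -/
theorem HasIncrementGram.exists_tendsto_slope [CompleteSpace H] (hΦ : HasIncrementGram Φ b x)
    (h : E) : ∃ v, Tendsto (fun t : ℝ => t⁻¹ • (Φ (x + t • h) - Φ x)) (𝓝[≠] 0) (𝓝 v) := by
  set u : ℝ → H := fun t => t⁻¹ • (Φ (x + t • h) - Φ x)
  have hT : Tendsto (fun p : ℝ × ℝ => inner ℝ (u p.1) (u p.2)) (𝓝[≠] 0 ×ˢ 𝓝[≠] 0)
    (𝓝 (b h h)) := hΦ.tendsto_inner_slope h h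
  refine cauchy_map_iff_exists_tendsto.1 (cauchy_map_iff.2 ⟨inferInstance, ?_⟩)
  rw [tendsto_uniformity_iff_dist_tendsto_zero]
  have h1 := hT.comp (tendsto_fst.prodMk (tendsto_fst (f := 𝓝[≠] (0 : ℝ)) (g := 𝓝[≠] (0 : ℝ))))
  have h2 := hT.comp (tendsto_snd.prodMk (tendsto_snd (f := 𝓝[≠] (0 : ℝ)) (g := 𝓝[≠] (0 : ℝ))))
  have h3 := ((h1.sub (hT.const_mul 2)).add h2).sqrt
  have e0 : √(b h h - 2 * b h h + b h h) = 0 := by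
    rw [show b h h - 2 * b h h + b h h = 0 by ring, Real.sqrt_zero]
  rw [e0] at h3
  refine h3.congr fun p => ?_
  simp only [Function.comp_apply]
  rw [dist_eq_norm, real_inner_self_eq_norm_sq, real_inner_self_eq_norm_sq,
    ← norm_sub_sq_real, Real.sqrt_sq (norm_nonneg _)]

/-- A map with values in a Hilbert space whose increments have, to first order, the Gram function
of a bounded bilinear form is strictly differentiable. -/
theorem HasIncrementGram.exists_hasStrictFDerivAt [CompleteSpace H]
    (hΦ : HasIncrementGram Φ b x) :
    ∃ L : E →L[ℝ] H, HasStrictFDerivAt Φ L x ∧ ∀ h k, inner ℝ (L h) (L k) = b h k := by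
  choose v hv using hΦ.exists_tendsto_slope
  have hvv : ∀ h k, inner ℝ (v h) (v k) = b h k := fun h k =>
    tendsto_nhds_unique (((hv h).comp tendsto_fst).inner ((hv k).comp tendsto_snd))
      (hΦ.tendsto_inner_slope h k)
  obtain ⟨L, rfl⟩ := exists_clm_of_inner_eq v b hvv
  refine ⟨L, ?_, hvv⟩
  rw [hasStrictFDerivAt_iff_isLittleO, Asymptotics.isLittleO_iff]
  intro c hc
  -- The squared remainder collects one Gram error and twice a cross-term error, in all at most `3 /
  -- 4 * c ^ 2 * ‖y - z‖ ^ 2`.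
  obtain ⟨δ, hδ, hb⟩ := hΦ (c ^ 2 / 4) (by positivity)
  have hx := mem_ball_self (x := x) hδ
  have hball : ball x δ ×ˢ ball x δ ∈ 𝓝 (x, x) :=
    prod_mem_nhds (ball_mem_nhds x hδ) (ball_mem_nhds x hδ)
  filter_upwards [hball] with ⟨y, z⟩ ⟨hy, hz⟩
  dsimp only at hy hz ⊢
  have hL : |inner ℝ (Φ y - Φ z) (L (y - z)) - b (y - z) (y - z)|
      ≤ c ^ 2 / 4 * ‖y - z‖ * ‖y - z‖ := by
    -- The cross term is the limit, as `t → 0`, of the increment estimate with second pair `x + t •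
    -- (y - z)`, `x`, divided by `t`.
    refine le_of_tendsto (((tendsto_const_nhds.inner (hv (y - z))).sub_const _).abs) ?_
    have hnear : ∀ᶠ t in 𝓝[≠] (0 : ℝ), t ≠ 0 ∧ x + t • (y - z) ∈ ball x δ := by
      refine eventually_mem_nhdsWithin.and (nhdsWithin_le_nhds ?_)
      have : Continuous fun t : ℝ => x + t • (y - z) := by fun_prop
      exact this.continuousAt.eventually (isOpen_ball.mem_nhds (by simpa using hδ))
    filter_upwards [hnear] with t ⟨ht, hty⟩
    have := hb _ hy _ hz _ hty _ hx
    rw [add_sub_cancel_left, map_smul, smul_eq_mul, norm_smul, Real.norm_eq_abs] at this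
    have ht' : 0 < |t| := abs_pos.2 ht
    rw [inner_smul_right]
    have e1 : t⁻¹ * inner ℝ (Φ y - Φ z) (Φ (x + t • (y - z)) - Φ x) - b (y - z) (y - z)
      = t⁻¹ * (inner ℝ (Φ y - Φ z) (Φ (x + t • (y - z)) - Φ x) - t * b (y - z) (y - z)) := by
      field_simp
    rw [e1, abs_mul, abs_inv, inv_mul_le_iff₀ ht']
    linarith
  have hd := hb _ hy _ hz _ hy _ hz
  refine le_of_sq_le_sq ?_ (by positivity)
  rw [norm_sub_sq_real, ← real_inner_self_eq_norm_sq, ← real_inner_self_eq_norm_sq (L _), hvv,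
    mul_pow]
  have := abs_le.1 hL
  have := abs_le.1 hd
  nlinarith [sq_nonneg (c * ‖y - z‖)]

end Derivative

/-- A map that is strictly differentiable at each point of an open set is `C^1` there. -/
theorem contDiffOn_one_of_hasStrictFDerivAt {f : E → V} {s : Set E} (hs : IsOpen s)
    {f' : E → E →L[ℝ] V} (hf : ∀ x ∈ s, HasStrictFDerivAt f (f' x) x) : ContDiffOn ℝ 1 f s := by
  rw [show (1 : WithTop ℕ∞) = 0 + 1 by simp, contDiffOn_succ_iff_fderiv_of_isOpen hs]
  refine ⟨fun x hx => (hf x hx).hasFDerivAt.differentiableAt.differentiableWithinAt, by simp, ?_⟩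
  rw [contDiffOn_zero]
  refine fun x hx => ContinuousAt.continuousWithinAt ?_
  rw [ContinuousAt, Metric.tendsto_nhds]
  intro ε hε
  -- The strict estimate at `x` holds near `(y, y)` for every `y` close to `x`, so it bounds the
  -- norm of the derivative of `f - f' x` at `y`.
  have h := ((hasStrictFDerivAt_iff_isLittleO.1 (hf x hx)).def (half_pos hε)).eventually_nhds
  rw [nhds_prod_eq] at h
  have h' := (Filter.tendsto_id.prodMk Filter.tendsto_id).eventually h
  filter_upwards [h', hs.mem_nhds hx] with y hy hys
  rw [dist_eq_norm, (hf x hx).hasFDerivAt.fderiv]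
  refine lt_of_le_of_lt (HasFDerivAt.le_of_lip'
    ((hf y hys).hasFDerivAt.differentiableAt.hasFDerivAt.sub (f' x).hasFDerivAt)
    (half_pos hε).le ?_) (half_lt_self hε)
  have : Tendsto (fun z => (z, y)) (𝓝 y) (𝓝 (y, y)) :=
    (Continuous.prodMk_left y).tendsto y
  filter_upwards [this.eventually hy] with z hz
  refine le_trans (le_of_eq ?_) hz
  congr 1
  simp only [Pi.sub_apply, map_sub]
  abel

end Calculus

/-! ### Injective linear maps from finite-dimensional spaces into Hilbert spaces -/

section Splitting

variable {E H : Type*} [NormedAddCommGroup E] [NormedSpace ℝ E] [FiniteDimensional ℝ E]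
  [NormedAddCommGroup H] [InnerProductSpace ℝ H]

/-- An injective linear map from a finite-dimensional space into a Hilbert space splits. -/
theorem exists_equiv_prod_orthogonal_range [CompleteSpace H] (A : E →L[ℝ] H)
    (hA : Function.Injective A) :
    ∃ e : (E × (A.range)ᗮ) ≃L[ℝ] H, ∀ u, e (u, 0) = A u := by
  have : CompleteSpace E := FiniteDimensional.complete ℝ E
  refine ⟨ContinuousLinearEquiv.ofBijective (A.coprod (A.range)ᗮ.subtypeL) ?_ ?_, fun u => ?_⟩
  · rw [LinearMap.ker_eq_bot']
    rintro ⟨u, w⟩ huw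
    have huw : A u + (w : H) = 0 := huw
    have hw : (w : H) ∈ A.range := by
      rw [← neg_eq_of_add_eq_zero_right huw]
      exact neg_mem (LinearMap.mem_range_self _ u)
    have hw0 : (w : H) = 0 := by
      have := Submodule.inner_right_of_mem_orthogonal hw w.2
      exact inner_self_eq_zero.1 this
    rw [hw0, add_zero] at huw
    rw [Prod.mk_eq_zero]
    exact ⟨hA (by rw [huw, map_zero]), Subtype.ext hw0⟩
  · rw [LinearMap.range_eq_top]
    intro h
    obtain ⟨u, hu⟩ := (A.range.orthogonalProjectionOnto h).2
    refine ⟨(u, ⟨h - A.range.starProjection h, A.range.sub_starProjection_mem_orthogonal h⟩), ?_⟩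
    change A u + (h - A.range.starProjection h) = h
    change A u = A.range.starProjection h at hu
    rw [hu]; abel
  · change A u + ((0 : (A.range)ᗮ) : H) = A u
    simp

/-- Two injective linear maps from a finite-dimensional space into a Hilbert space differ by an
automorphism of the target. -/
theorem exists_equiv_comp_eq (A B : E →L[ℝ] H) (hA : Function.Injective A)
    (hB : Function.Injective B) : ∃ T : H ≃L[ℝ] H, ∀ u, T (A u) = B u := by
  let U : Submodule ℝ H := A.range ⊔ B.range
  have hAU : ∀ u, A u ∈ U := fun u => Submodule.mem_sup_left (LinearMap.mem_range_self _ u)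
  have hBU : ∀ u, B u ∈ U := fun u => Submodule.mem_sup_right (LinearMap.mem_range_self _ u)
  let A' : E →ₗ[ℝ] U := (A : E →ₗ[ℝ] H).codRestrict U hAU
  let B' : E →ₗ[ℝ] U := (B : E →ₗ[ℝ] H).codRestrict U hBU
  have hA' : Function.Injective A' := fun u v h => hA (congrArg Subtype.val h)
  have hB' : Function.Injective B' := fun u v h => hB (congrArg Subtype.val h)
  -- In the finite-dimensional space `U`, the isomorphism between the two ranges extends to an
  -- automorphism `g`. The map `S g` below acts as `g` on `U` and as the identity on its orthogonal
  -- complement.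
  obtain ⟨g, hg⟩ := Submodule.exists_linearEquiv_restrict_eq
    ((LinearEquiv.ofInjective A' hA').symm ≪≫ₗ LinearEquiv.ofInjective B' hB')
  have hgA : ∀ u, g (A' u) = B' u := fun u => by
    have := hg (LinearEquiv.ofInjective A' hA' u)
    rw [LinearEquiv.trans_apply, LinearEquiv.symm_apply_apply] at this
    exact this.symm
  let P := U.orthogonalProjectionOnto
  let S : (U →ₗ[ℝ] U) → (H →L[ℝ] H) := fun k =>
    U.subtypeL ∘L (LinearMap.toContinuousLinearMap k) ∘L P
      + (ContinuousLinearMap.id ℝ H - U.subtypeL ∘L P)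
  have hS : ∀ k h, S k h = (k (P h) : H) + (h - (P h : H)) := fun k h => rfl
  have hPS : ∀ k h, P (S k h) = k (P h) := fun k h => by
    have hP : ∀ w : U, P (w : H) = w := U.orthogonalProjectionOnto_mem_subspace_eq_self
    rw [hS, map_add, map_sub, hP, hP, sub_self, add_zero]
  have hinv : ∀ k k' : U →ₗ[ℝ] U, (∀ w, k' (k w) = w) → ∀ h, S k' (S k h) = h := by
    intro k k' hk h
    rw [hS k' (S k h), hPS, hk, hS]
    abel
  refine ⟨ContinuousLinearEquiv.equivOfInverse (S g) (S g.symm)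
    (hinv _ _ fun w => g.symm_apply_apply w) (hinv _ _ fun w => g.apply_symm_apply w), fun u => ?_⟩
  change S g (A u) = B u
  have hP : P (A u) = A' u :=
    U.orthogonalProjectionOnto_mem_subspace_eq_self (A' u)
  rw [hS, hP]
  change (g (A' u) : H) + (A u - A u) = B u
  rw [hgA, sub_self, add_zero]
  rfl

end Splitting

/-! ### Normal form of immersions and local left inverses -/

section Immersion

variable {E F H : Type*} [NormedAddCommGroup E] [NormedSpace ℝ E]
  [NormedAddCommGroup F] [NormedSpace ℝ F] [NormedAddCommGroup H] [NormedSpace ℝ H]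

/-- The inverse function theorem as the existence of a local `C^1` diffeomorphism. -/
theorem ContDiffAt.exists_openPartialHomeomorph_contDiffOn [CompleteSpace H] {f : H → H} {a : H}
    {f' : H ≃L[ℝ] H} (hf : ContDiffAt ℝ 1 f a) (hf' : HasFDerivAt f (f' : H →L[ℝ] H) a) :
    ∃ φ : OpenPartialHomeomorph H H, ⇑φ = f ∧ a ∈ φ.source ∧ ContDiffOn ℝ 1 φ φ.source ∧
      ContDiffOn ℝ 1 φ.symm φ.target := by
  let ρ := hf.toOpenPartialHomeomorph f hf' one_ne_zero
  have ha : a ∈ ρ.source := hf.mem_toOpenPartialHomeomorph_source hf' one_ne_zero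
  have hsymm : ContDiffAt ℝ 1 ρ.symm (f a) := hf.to_localInverse hf' one_ne_zero
  have h1 : ∀ᶠ y in 𝓝 a, ContDiffAt ℝ 1 f y := hf.eventually (by simp)
  have h2 : ∀ᶠ y in 𝓝 a, ContDiffAt ℝ 1 ρ.symm (f y) :=
    hf.continuousAt.eventually (hsymm.eventually (by simp))
  -- The local inverse is so far `C^1` only near `f a`; restricting to `O` makes both directions
  -- `C^1` on their whole domains.
  obtain ⟨O, hO, hOo, haO⟩ := _root_.eventually_nhds_iff.1 (h1.and h2)
  refine ⟨ρ.restrOpen O hOo, rfl, ?_, ?_, ?_⟩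
  · rw [OpenPartialHomeomorph.restrOpen_source]
    exact ⟨ha, haO⟩
  · rw [OpenPartialHomeomorph.restrOpen_source]
    exact fun y hy => (hO y hy.2).1.contDiffWithinAt
  · intro z hz
    have hz' := (ρ.restrOpen O hOo).map_target hz
    rw [OpenPartialHomeomorph.restrOpen_source] at hz'
    have h := (hO _ hz'.2).2
    have e : f ((ρ.restrOpen O hOo).symm z) = z := (ρ.restrOpen O hOo).right_inv hz
    rw [e] at h
    exact h.contDiffWithinAt

/-- Normal form of an immersion: a `C^1` map whose derivative at `x` splits is `u ↦ (u, 0)` in a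
`C^1` chart of the target. -/
theorem ContDiffAt.exists_immersion_chart [CompleteSpace H] {Φ : E → H} {x : E} {L : E →L[ℝ] H}
    (hΦ : ContDiffAt ℝ 1 Φ x) (hL : HasFDerivAt Φ L x) (e : (E × F) ≃L[ℝ] H)
    (he : ∀ u, e (u, 0) = L u) :
    ∃ ψ : OpenPartialHomeomorph H H, ContDiffOn ℝ 1 ψ ψ.source ∧
      ContDiffOn ℝ 1 ψ.symm ψ.target ∧ e (x, 0) ∈ ψ.target ∧
      ∀ u, e (u, 0) ∈ ψ.target → Φ u ∈ ψ.source ∧ ψ (Φ u) = e (u, 0) := by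
  -- Thickening of `Φ` by the complement: `f (e (u, w)) = Φ u + e (0, w)`. As `e (u, 0) = L u`, its
  -- derivative at `e (x, 0)` is the identity, and the inverse of `f` is the desired chart.
  let f : H → H := fun h => Φ (e.symm h).1 + e (0, (e.symm h).2)
  have hfe : ∀ u, f (e (u, 0)) = Φ u := fun u => by
    simp only [f, e.symm_apply_apply]
    rw [show ((0 : E), (0 : F)) = 0 from rfl, map_zero, add_zero]
  have hx : (e.symm (e (x, 0))).1 = x := by rw [e.symm_apply_apply]
  have hf : ContDiffAt ℝ 1 f (e (x, 0)) := by
    refine ContDiffAt.add (ContDiffAt.comp (e (x, 0)) (by rwa [hx])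
      (contDiff_fst.comp e.symm.contDiff).contDiffAt) ?_
    exact (e.contDiff.comp (contDiff_const.prodMk
      (contDiff_snd.comp e.symm.contDiff))).contDiffAt
  have hf' : HasFDerivAt f ((ContinuousLinearEquiv.refl ℝ H : H ≃L[ℝ] H) : H →L[ℝ] H)
      (e (x, 0)) := by
    have h1 : HasFDerivAt (fun h => (e.symm h).1) (ContinuousLinearMap.fst ℝ E F ∘L
      (e.symm : H →L[ℝ] E × F)) (e (x, 0)) :=
      (ContinuousLinearMap.fst ℝ E F ∘L (e.symm : H →L[ℝ] E × F)).hasFDerivAt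
    have h2 : HasFDerivAt (fun h => e (0, (e.symm h).2)) ((e : (E × F) →L[ℝ] H) ∘L
      ContinuousLinearMap.inr ℝ E F ∘L ContinuousLinearMap.snd ℝ E F ∘L
      (e.symm : H →L[ℝ] E × F)) (e (x, 0)) :=
      ((e : (E × F) →L[ℝ] H) ∘L ContinuousLinearMap.inr ℝ E F ∘L
        ContinuousLinearMap.snd ℝ E F ∘L (e.symm : H →L[ℝ] E × F)).hasFDerivAt
    rw [← hx] at hL
    refine ((hL.comp (e (x, 0)) h1).add h2).congr_fderiv ?_
    ext h
    change L (e.symm h).1 + e (0, (e.symm h).2) = h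
    rw [← he, ← map_add, Prod.mk_add_mk, add_zero, zero_add]
    exact e.apply_symm_apply h
  obtain ⟨φ, hφ, ha, hc, hc'⟩ := hf.exists_openPartialHomeomorph_contDiffOn hf'
  refine ⟨φ.symm, hc', hc, ha, fun u hu => ?_⟩
  have h : φ (e (u, 0)) = Φ u := by rw [hφ, hfe]
  rw [← h]
  exact ⟨φ.map_source hu, φ.left_inv hu⟩

/-- A `C^1` map whose derivative at `x` splits is an immersion at `x`. -/
theorem isImmersionAtOfComplement_of_hasFDerivAt [CompleteSpace H] (X : TopologicalSpace.Opens E)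
    {Φ : E → H} (x : X) {L : E →L[ℝ] H} (hΦ : ContDiffAt ℝ 1 Φ x) (hL : HasFDerivAt Φ L x)
    (e : (E × F) ≃L[ℝ] H) (he : ∀ u, e (u, 0) = L u) :
    Manifold.IsImmersionAtOfComplement F 𝓘(ℝ, E) 𝓘(ℝ, H) 1 (fun y : X => Φ y) x := by
  obtain ⟨ψ, hψ, hψ', hx, h⟩ := hΦ.exists_immersion_chart hL e he
  have hO : IsOpen {y : X | e ((y : E), 0) ∈ ψ.target} :=
    ψ.open_target.preimage (by fun_prop)
  refine Manifold.IsImmersionAtOfComplement.mk_of_continuousAt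
    (hΦ.continuousAt.comp continuous_subtype_val.continuousAt) e
    ((chartAt E x).restrOpen _ hO) ψ ?_ (h x hx).1 ?_ ?_ ?_
  · rw [OpenPartialHomeomorph.restrOpen_source]
    exact ⟨mem_chart_source E x, hx⟩
  · have := restr_mem_maximalAtlas (contDiffGroupoid 1 𝓘(ℝ, E))
      (IsManifold.chart_mem_maximalAtlas (I := 𝓘(ℝ, E)) (n := 1) x) hO
    rwa [OpenPartialHomeomorph.restr, show (chartAt E x).restrOpen (interior _) isOpen_interior
      = (chartAt E x).restrOpen _ hO by congr 1; exact hO.interior_eq] at this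
  · exact ψ.mem_maximalAtlas_of_contMDiffOn hψ.contMDiffOn hψ'.contMDiffOn
  · intro v hv
    set c := (chartAt E x).restrOpen _ hO
    have hv' : v ∈ c.target := by simpa using hv
    have hs := c.map_target hv'
    rw [OpenPartialHomeomorph.restrOpen_source] at hs
    have hval : ((c.symm v : X) : E) = v := c.right_inv hv'
    have hs2 : e (((c.symm v : X) : E), 0) ∈ ψ.target := hs.2
    rw [hval] at hs2
    change ψ (Φ ((c.symm v : X) : E)) = e (v, 0)
    rw [hval]
    exact (h v hs2).2

/-- A `C^1` map on an open subset of a finite-dimensional space, with values in a Hilbert space and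
with injective derivatives, is an immersion. -/
theorem isImmersion_of_injective_fderiv {E H : Type*} [NormedAddCommGroup E] [NormedSpace ℝ E]
    [FiniteDimensional ℝ E] [NormedAddCommGroup H] [InnerProductSpace ℝ H] [CompleteSpace H]
    (X : TopologicalSpace.Opens E) {Φ : E → H} (hΦ : ContDiffOn ℝ 1 Φ X)
    (hinj : ∀ x ∈ X, Function.Injective (fderiv ℝ Φ x)) :
    Manifold.IsImmersion 𝓘(ℝ, E) 𝓘(ℝ, H) 1 (fun y : X => Φ y) := by
  rcases isEmpty_or_nonempty X with hX | ⟨⟨x₀, hx₀⟩⟩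
  · exact ⟨H, inferInstance, inferInstance, fun x => hX.elim x⟩
  obtain ⟨e, he⟩ := exists_equiv_prod_orthogonal_range _ (hinj x₀ hx₀)
  refine ⟨((fderiv ℝ Φ x₀).range)ᗮ, inferInstance, inferInstance, fun x => ?_⟩
  -- One complement must serve all points of `X`, so the splitting at `x₀` is transported to `x` by
  -- an automorphism of `H`.
  obtain ⟨T, hT⟩ := exists_equiv_comp_eq _ _ (hinj x₀ hx₀) (hinj x x.2)
  have hc : ContDiffAt ℝ 1 Φ x := hΦ.contDiffAt (X.isOpen.mem_nhds x.2)
  refine isImmersionAtOfComplement_of_hasFDerivAt X x hc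
    (hc.differentiableAt one_ne_zero).hasFDerivAt (e.trans T) fun u => ?_
  rw [ContinuousLinearEquiv.trans_apply, he, hT]

/-- An embedding which is a `C^1` immersion has local `C^1` left inverses. -/
theorem exists_contDiffOn_leftInverse {E H : Type*} [NormedAddCommGroup E] [NormedSpace ℝ E]
    [FiniteDimensional ℝ E] [NormedAddCommGroup H] [InnerProductSpace ℝ H] [CompleteSpace H]
    (X : TopologicalSpace.Opens E) {Φ : E → H} (hΦ : ContDiffOn ℝ 1 Φ X)
    (hemb : IsEmbedding (fun y : X => Φ y)) {x : E} (hx : x ∈ X)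
    (hinj : Function.Injective (fderiv ℝ Φ x)) :
    ∃ U : Set H, IsOpen U ∧ Φ x ∈ U ∧ ∃ r : H → E, ContDiffOn ℝ 1 r U ∧ MapsTo r U X ∧
      ∀ y ∈ X, Φ y ∈ U → r (Φ y) = y := by
  obtain ⟨e, he⟩ := exists_equiv_prod_orthogonal_range _ hinj
  have hc : ContDiffAt ℝ 1 Φ x := hΦ.contDiffAt (X.isOpen.mem_nhds hx)
  obtain ⟨ψ, hψ, -, hxψ, h⟩ := hc.exists_immersion_chart
    (hc.differentiableAt one_ne_zero).hasFDerivAt e he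
  have hO : IsOpen {y : X | e ((y : E), 0) ∈ ψ.target} :=
    ψ.open_target.preimage (by fun_prop)
  -- The embedding property excludes distant sheets: `Φ y ∈ V` forces `y` into the region where the
  -- normal form is valid.
  obtain ⟨V, hV, hVO⟩ := hemb.isOpen_iff.1 hO
  have hVO' : ∀ y (hy : y ∈ X), Φ y ∈ V ↔ e (y, 0) ∈ ψ.target := fun y hy =>
    Set.ext_iff.1 hVO ⟨y, hy⟩
  let r : H → E := fun z => (e.symm (ψ z)).1
  have hr : ContDiffOn ℝ 1 r ψ.source :=
    (contDiff_fst.comp e.symm.contDiff).comp_contDiffOn hψ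
  have hrΦ : ∀ y ∈ X, Φ y ∈ V → r (Φ y) = y := fun y hy hyV => by
    simp only [r]
    rw [(h y ((hVO' y hy).1 hyV)).2, e.symm_apply_apply]
  have hxV : Φ x ∈ V := (hVO' x hx).2 hxψ
  refine ⟨V ∩ (ψ.source ∩ r ⁻¹' X), hV.inter (hr.continuousOn.isOpen_inter_preimage ψ.open_source
    X.isOpen), ⟨hxV, (h x hxψ).1, ?_⟩, r, hr.mono fun z hz => hz.2.1, fun z hz => hz.2.2,
    fun y hy hyU => hrΦ y hy hyU.1⟩
  rw [mem_preimage, hrΦ x hx hxV]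
  exact hx

end Immersion

/-! ### Functions and gradients on the image of an embedding -/

section Submanifold

variable {E V H : Type*} [NormedAddCommGroup E] [NormedSpace ℝ E]
  [NormedAddCommGroup V] [NormedSpace ℝ V] [NormedAddCommGroup H]

/-- A `C^1` function on the source of an embedding, transported to the image, is `C^1` there. -/
theorem isC1OnSubmanifold_comp_invFunOn [NormedSpace ℝ H] {X : Set E} {Φ : E → H}
    (hinj : InjOn Φ X)
    (hr : ∀ x ∈ X, ∃ U : Set H, IsOpen U ∧ Φ x ∈ U ∧ ∃ r : H → E, ContDiffOn ℝ 1 r U ∧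
      MapsTo r U X ∧ ∀ y ∈ X, Φ y ∈ U → r (Φ y) = y)
    {F : E → V} (hF : ContDiffOn ℝ 1 F X) :
    IsC1OnSubmanifold (F ∘ Function.invFunOn Φ X) (Φ '' X) := by
  rintro _ ⟨x, hx, rfl⟩
  obtain ⟨U, hU, hxU, r, hrc, hrX, hrΦ⟩ := hr x hx
  refine ⟨U, hU, hxU, F ∘ r, hF.comp hrc hrX, ?_⟩
  rintro _ ⟨⟨y, hy, rfl⟩, hyU⟩
  rw [Function.comp_apply, Function.comp_apply, hrΦ y hy hyU, hinj.leftInvOn_invFunOn hy]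

/-- The gradient of a function on the image of an embedding `Φ` is `DΦ w`, where
`DΦ^* DΦ w` is the gradient of the function on the source. -/
theorem hasGradientOnSubmanifold_comp_invFunOn {E : Type*} [NormedAddCommGroup E]
    [InnerProductSpace ℝ E] [CompleteSpace E] [InnerProductSpace ℝ H] [CompleteSpace H]
    {X : Set E} (hX : IsOpen X) {Φ : E → H} (hΦ : ContDiffOn ℝ 1 Φ X) (hinj : InjOn Φ X)
    {x : E} (hx : x ∈ X)
    (hr : ∃ U : Set H, IsOpen U ∧ Φ x ∈ U ∧ ∃ r : H → E, ContDiffOn ℝ 1 r U ∧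
      MapsTo r U X ∧ ∀ y ∈ X, Φ y ∈ U → r (Φ y) = y)
    {f : E → ℝ} (hf : DifferentiableAt ℝ f x) {w : E}
    (hw : (fderiv ℝ Φ x).adjoint (fderiv ℝ Φ x w) = gradient f x) :
    HasGradientOnSubmanifold (f ∘ Function.invFunOn Φ X) (Φ '' X) (Φ x) (fderiv ℝ Φ x w) := by
  have hc : ContDiffAt ℝ 1 Φ x := hΦ.contDiffAt (hX.mem_nhds hx)
  have hd : HasFDerivAt Φ (fderiv ℝ Φ x) x := (hc.differentiableAt one_ne_zero).hasFDerivAt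
  refine ⟨⟨fun t : ℝ => Φ (x + t • w), ⟨?_, ?_, ?_⟩, ?_⟩, fun γ hγ => ?_⟩
  · refine ContDiffAt.comp (0 : ℝ) (by simpa using hc) ?_
    exact (contDiff_const.add (contDiff_id.smul contDiff_const)).contDiffAt
  · have hcont : Continuous fun t : ℝ => x + t • w := by fun_prop
    filter_upwards [hcont.continuousAt.eventually (hX.mem_nhds (x := x + (0 : ℝ) • w)
      (by simpa using hx))] with t ht
    exact mem_image_of_mem Φ ht
  · simp
  · have h1 : HasDerivAt (fun t : ℝ => x + t • w) w 0 := by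
      simpa using ((hasDerivAt_id (0 : ℝ)).smul_const w).const_add x
    have h2 : HasFDerivAt Φ (fderiv ℝ Φ x) (x + (0 : ℝ) • w) := by simpa using hd
    exact (h2.comp_hasDerivAt (0 : ℝ) h1).deriv
  · obtain ⟨U, hU, hxU, r, hrc, hrX, hrΦ⟩ := hr
    have hγd : HasDerivAt γ (deriv γ 0) 0 :=
      (hγ.contDiffAt.differentiableAt one_ne_zero).hasDerivAt
    have hrd : DifferentiableAt ℝ r (γ 0) := by
      rw [hγ.base]
      exact (hrc.contDiffAt (hU.mem_nhds hxU)).differentiableAt one_ne_zero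
    have hu := hrd.hasFDerivAt.comp_hasDerivAt (0 : ℝ) hγd
    have hu0 : r (γ 0) = x := by rw [hγ.base, hrΦ x hx hxU]
    set v := fderiv ℝ r (γ 0) (deriv γ 0)
    -- Near `0` the curve lifts to `r ∘ γ` in `X`, so its velocity is `DΦ v`, with `v` the velocity
    -- of the lift.
    have hev : ∀ᶠ t in 𝓝 (0 : ℝ), γ t = Φ (r (γ t)) ∧
        f (Function.invFunOn Φ X (γ t)) = f (r (γ t)) := by
      filter_upwards [hγ.mem, hγ.contDiffAt.continuousAt.eventually
        (hU.mem_nhds (by rwa [hγ.base]))] with t ⟨y, hy, hyt⟩ htU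
      rw [← hyt] at htU ⊢
      rw [hrΦ y hy htU, hinj.leftInvOn_invFunOn hy]
      exact ⟨rfl, rfl⟩
    have hγv : deriv γ 0 = fderiv ℝ Φ x v := by
      rw [← hu0] at hd
      have := (hd.comp_hasDerivAt (0 : ℝ) hu).congr_of_eventuallyEq
        (hev.mono fun t ht => ht.1)
      rw [this.deriv, hu0]
    have hfv : HasDerivAt (f ∘ r ∘ γ) (fderiv ℝ f x v) 0 := by
      have hf' := hf.hasFDerivAt
      rw [← hu0] at hf'
      have := hf'.comp_hasDerivAt (0 : ℝ) hu
      rwa [hu0] at this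
    refine (hfv.congr_of_eventuallyEq (hev.mono fun t ht => ht.2)).congr_deriv ?_
    rw [hγv, ← ContinuousLinearMap.adjoint_inner_left, hw, gradient,
      InnerProductSpace.toDual_symm_apply]

end Submanifold

/-! ### From kernel regularity to the feature map -/

section FeatureMap

/-- The inner products of the feature map are the values of the kernel. -/
theorem inner_featureMap {E : Type*} {S : Set E} {H : Type*} [NormedAddCommGroup H]
    [InnerProductSpace ℝ H] [CompleteSpace H] [RKHS ℝ H S ℝ] {x y : E} (hx : x ∈ S) (hy : y ∈ S) :
    inner ℝ (featureMap S H x) (featureMap S H y) = RKHS.kernel H ⟨x, hx⟩ ⟨y, hy⟩ (1 : ℝ) := by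
  rw [featureMap, featureMap, dif_pos hx, dif_pos hy, real_inner_comm, ← RKHS.kernel_inner]
  simp

variable {E H : Type*} [NormedAddCommGroup E] [NormedAddCommGroup H]
  [InnerProductSpace ℝ H] {K : E × E → ℝ} {Φ : E → H}

/-- Continuity follows from `‖Φ y - Φ x‖ ^ 2 = K (y, y) - 2 K (y, x) + K (x, x)`, which tends to
zero as `y → x`. -/
theorem continuousOn_of_inner_eq {S : Set E}
    (hΦ : ∀ x ∈ S, ∀ y ∈ S, inner ℝ (Φ x) (Φ y) = K (x, y)) (hK : ContinuousOn K (S ×ˢ S)) :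
    ContinuousOn Φ S := by
  intro x hx
  rw [ContinuousWithinAt, tendsto_iff_norm_sub_tendsto_zero]
  have hpair : ∀ {u v : E → E}, ContinuousWithinAt u S x → ContinuousWithinAt v S x →
      MapsTo u S S → MapsTo v S S →
      Tendsto (fun y => K (u y, v y)) (𝓝[S] x) (𝓝 (K (u x, v x))) :=
    fun {u v} hu hv huS hvS => ContinuousWithinAt.comp (f := fun y => (u y, v y))
      (hK (u x, v x) ⟨huS hx, hvS hx⟩) (hu.prodMk hv) fun y hy => ⟨huS hy, hvS hy⟩
  have h1 := hpair continuousWithinAt_id continuousWithinAt_id (mapsTo_id S) (mapsTo_id S)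
  have h2 := hpair continuousWithinAt_id continuousWithinAt_const (mapsTo_id S) fun _ _ => hx
  have h3 := ((h1.sub (h2.const_mul 2)).add_const (K (x, x))).sqrt
  simp only [id] at h3
  rw [show K (x, x) - 2 * K (x, x) + K (x, x) = 0 by ring, Real.sqrt_zero] at h3
  refine h3.congr' ?_
  filter_upwards [self_mem_nhdsWithin] with y hy
  rw [← hΦ y hy y hy, ← hΦ y hy x hx, ← hΦ x hx x hx, real_inner_self_eq_norm_sq,
    real_inner_self_eq_norm_sq, ← norm_sub_sq_real, Real.sqrt_sq (norm_nonneg _)]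

theorem hasIncrementGram_of_inner_eq [NormedSpace ℝ E] {S : Set E} {x : E} (hS : S ∈ 𝓝 x)
    (hΦ : ∀ x ∈ S, ∀ y ∈ S, inner ℝ (Φ x) (Φ y) = K (x, y)) (hK : ContDiffAt ℝ 2 K (x, x)) :
    HasIncrementGram Φ (mixedDeriv K x) x := by
  intro ε hε
  obtain ⟨δ, hδ, h⟩ := mixed_difference_estimate hK hε
  obtain ⟨η, hη, hηS⟩ := Metric.mem_nhds_iff.1 hS
  have m1 := ball_subset_ball (x := x) (min_le_left δ η)
  have m2 := (ball_subset_ball (x := x) (min_le_right δ η)).trans hηS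
  refine ⟨min δ η, lt_min hδ hη, fun y hy z hz y' hy' z' hz' => ?_⟩
  refine le_trans (le_of_eq ?_) (h y (m1 hy) z (m1 hz) y' (m1 hy') z' (m1 hz'))
  rw [inner_sub_left, inner_sub_right, inner_sub_right, hΦ y (m2 hy) y' (m2 hy'),
    hΦ y (m2 hy) z' (m2 hz'), hΦ z (m2 hz) y' (m2 hy'), hΦ z (m2 hz) z' (m2 hz')]
  congr 1; ring

end FeatureMap

/-! ### The derivative Gram matrix as an operator -/

section Gram

variable {n : ℕ}

/-- The outer differentiation is in the first argument on both sides, so no symmetry of the second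
derivative is needed. -/
theorem derivGram_apply {K : EuclideanSpace ℝ (Fin n) × EuclideanSpace ℝ (Fin n) → ℝ}
    {x : EuclideanSpace ℝ (Fin n)} (hK : ContDiffAt ℝ 2 K (x, x)) (i j : Fin n) :
    derivGram K x i j =
      mixedDeriv K x (EuclideanSpace.single i 1) (EuclideanSpace.single j 1) := by
  have hd : ∀ᶠ p in 𝓝 (x, x), DifferentiableAt ℝ K p :=
    (hK.eventually (by simp)).mono fun p hp => hp.differentiableAt (by norm_num)
  have hd' : ∀ᶠ y in 𝓝 x, DifferentiableAt ℝ K (y, x) :=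
    ((Continuous.prodMk_left x).tendsto x).eventually hd
  have h1 : (fun y => fderiv ℝ (fun y' => K (y, y')) x (EuclideanSpace.single j 1)) =ᶠ[𝓝 x]
      fun y => fderiv ℝ K (y, x) (0, EuclideanSpace.single j 1) := by
    filter_upwards [hd'] with y hy
    have := hy.hasFDerivAt.comp x (hasFDerivAt_prodMk_right y x)
    exact congrArg (fun l : EuclideanSpace ℝ (Fin n) →L[ℝ] ℝ => l (EuclideanSpace.single j 1))
      this.fderiv
  have h2 : HasFDerivAt (fderiv ℝ K) (fderiv ℝ (fderiv ℝ K) (x, x)) (x, x) :=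
    ((hK.fderiv_right (m := 1) (by norm_num)).differentiableAt one_ne_zero).hasFDerivAt
  have h3 := (HasFDerivAt.comp (f := fun y => (y, x)) x h2 (hasFDerivAt_prodMk_left x x)).clm_apply
    (hasFDerivAt_const ((0 : EuclideanSpace ℝ (Fin n)), EuclideanSpace.single j (1 : ℝ)) x)
  change fderiv ℝ _ x (EuclideanSpace.single i 1) = _
  rw [h1.fderiv_eq]
  refine (congrArg (fun l : EuclideanSpace ℝ (Fin n) →L[ℝ] ℝ => l (EuclideanSpace.single i 1))
    h3.fderiv).trans ?_
  simp [mixedDeriv_apply]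

/-- The composition of the adjoint of an operator with the operator is the Gram matrix of the
images of the standard basis vectors. -/
theorem adjoint_comp_self_eq_toEuclideanCLM {H : Type*} [NormedAddCommGroup H]
    [InnerProductSpace ℝ H] [CompleteSpace H] (L : EuclideanSpace ℝ (Fin n) →L[ℝ] H)
    {G : Matrix (Fin n) (Fin n) ℝ}
    (hG : ∀ i j, inner ℝ (L (EuclideanSpace.single i 1)) (L (EuclideanSpace.single j 1)) = G i j) :
    L.adjoint ∘L L = Matrix.toEuclideanCLM (𝕜 := ℝ) G := by
  refine ContinuousLinearMap.coe_injective
    ((EuclideanSpace.basisFun (Fin n) ℝ).toBasis.ext fun j => ?_)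
  ext i
  have h := hG i j
  rw [← ContinuousLinearMap.adjoint_inner_right, EuclideanSpace.inner_single_left] at h
  simpa using h

theorem toEuclideanCLM_apply_inv_apply {G : Matrix (Fin n) (Fin n) ℝ} (hG : IsUnit G)
    (v : EuclideanSpace ℝ (Fin n)) :
    Matrix.toEuclideanCLM (𝕜 := ℝ) G (Matrix.toEuclideanCLM (𝕜 := ℝ) G⁻¹ v) = v := by
  have h : Matrix.toEuclideanCLM (𝕜 := ℝ) G * Matrix.toEuclideanCLM (𝕜 := ℝ) G⁻¹ = 1 := by
    rw [← map_mul, Matrix.mul_nonsing_inv _ ((Matrix.isUnit_iff_isUnit_det G).1 hG), map_one]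
  exact congrArg (fun l : EuclideanSpace ℝ (Fin n) →L[ℝ] EuclideanSpace ℝ (Fin n) => l v) h

theorem injective_toEuclideanCLM {G : Matrix (Fin n) (Fin n) ℝ} (hG : IsUnit G) :
    Function.Injective (Matrix.toEuclideanCLM (𝕜 := ℝ) G) := by
  have h : Matrix.toEuclideanCLM (𝕜 := ℝ) G⁻¹ * Matrix.toEuclideanCLM (𝕜 := ℝ) G = 1 := by
    rw [← map_mul, Matrix.nonsing_inv_mul _ ((Matrix.isUnit_iff_isUnit_det G).1 hG), map_one]
  exact Function.LeftInverse.injective (g := Matrix.toEuclideanCLM (𝕜 := ℝ) G⁻¹) fun v =>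
    congrArg (fun l : EuclideanSpace ℝ (Fin n) →L[ℝ] EuclideanSpace ℝ (Fin n) => l v) h

end Gram

/-- A map that is continuous and injective on the compact closure of a set is an embedding of the
set. -/
theorem isEmbedding_of_injOn_closure {E H : Type*} [TopologicalSpace E] [TopologicalSpace H]
    [T2Space H] {X : Set E} (hX : IsCompact (closure X)) {Φ : E → H}
    (hc : ContinuousOn Φ (closure X)) (hinj : InjOn Φ (closure X)) :
    IsEmbedding (fun x : X => Φ x) := by
  have : CompactSpace (closure X) := isCompact_iff_compactSpace.1 hX
  have h : IsClosedEmbedding ((closure X).domRestrict Φ) :=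
    (continuousOn_iff_continuous_domRestrict.1 hc).isClosedEmbedding
      (injOn_iff_injective.1 hinj)
  exact h.isEmbedding.comp (IsEmbedding.inclusion subset_closure)

end

theorem mainTheorem1 {n : ℕ} (X : TopologicalSpace.Opens (EuclideanSpace ℝ (Fin n)))
    (hX : Bornology.IsBounded (X : Set (EuclideanSpace ℝ (Fin n))))
    {H : Type*} [NormedAddCommGroup H] [InnerProductSpace ℝ H] [CompleteSpace H]
    [RKHS ℝ H (closure (X : Set (EuclideanSpace ℝ (Fin n)))) ℝ]
    (K : EuclideanSpace ℝ (Fin n) × EuclideanSpace ℝ (Fin n) → ℝ)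
    (hK : ∀ x y : closure (X : Set (EuclideanSpace ℝ (Fin n))),
      K (x, y) = RKHS.kernel H x y (1 : ℝ))
    (hK2 : ContDiffUpToBoundary 2 K
      ((X : Set (EuclideanSpace ℝ (Fin n))) ×ˢ (X : Set (EuclideanSpace ℝ (Fin n)))))
    (hinj : InjOn (featureMap (closure (X : Set (EuclideanSpace ℝ (Fin n)))) H)
      (closure (X : Set (EuclideanSpace ℝ (Fin n)))))
    (hG : ∀ x ∈ X, (derivGram K x).PosDef) :
    let Φ : EuclideanSpace ℝ (Fin n) → H :=
      featureMap (closure (X : Set (EuclideanSpace ℝ (Fin n)))) H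
    ContDiffOn ℝ 1 Φ X ∧
    (∀ x ∈ X, (fderiv ℝ Φ x).adjoint ∘L fderiv ℝ Φ x =
      Matrix.toEuclideanCLM (𝕜 := ℝ) (derivGram K x)) ∧
    Manifold.IsSmoothEmbedding 𝓘(ℝ, EuclideanSpace ℝ (Fin n)) 𝓘(ℝ, H) 1 (fun x : X => Φ x) ∧
    ∀ (m : ℕ) (F : EuclideanSpace ℝ (Fin n) → EuclideanSpace ℝ (Fin m)), ContDiffOn ℝ 1 F X →
      let F' : H → EuclideanSpace ℝ (Fin m) := F ∘ Function.invFunOn Φ X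
      (∀ x ∈ X, F' (Φ x) = F x) ∧
      IsC1OnSubmanifold F' (Φ '' X) ∧
      ∀ x ∈ X, ∀ ξ : EuclideanSpace ℝ (Fin m),
        HasGradientOnSubmanifold (fun h => inner ℝ ξ (F' h)) (Φ '' X) (Φ x)
          (fderiv ℝ Φ x (Matrix.toEuclideanCLM (𝕜 := ℝ) (derivGram K x)⁻¹
            (gradient (fun y => inner ℝ ξ (F y)) x))) := by
  intro Φ
  have hsub : (X : Set (EuclideanSpace ℝ (Fin n))) ⊆ closure X := subset_closure
  have hΦK : ∀ x ∈ closure (X : Set (EuclideanSpace ℝ (Fin n))),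
      ∀ y ∈ closure (X : Set (EuclideanSpace ℝ (Fin n))), inner ℝ (Φ x) (Φ y) = K (x, y) :=
    fun x hx y hy => (inner_featureMap hx hy).trans (hK ⟨x, hx⟩ ⟨y, hy⟩).symm
  have hKx : ∀ x ∈ X, ContDiffAt ℝ 2 K (x, x) := fun x hx =>
    hK2.2.1.contDiffAt ((X.isOpen.prod X.isOpen).mem_nhds ⟨hx, hx⟩)
  have hstrict : ∀ x ∈ X, ∃ L : EuclideanSpace ℝ (Fin n) →L[ℝ] H, HasStrictFDerivAt Φ L x ∧
      ∀ h k, inner ℝ (L h) (L k) = mixedDeriv K x h k := fun x hx =>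
    (hasIncrementGram_of_inner_eq (Filter.mem_of_superset (X.isOpen.mem_nhds hx) hsub) hΦK
      (hKx x hx)).exists_hasStrictFDerivAt
  have hgram : ∀ x ∈ X, ∀ h k,
      inner ℝ (fderiv ℝ Φ x h) (fderiv ℝ Φ x k) = mixedDeriv K x h k := fun x hx => by
    obtain ⟨L, hL, hLK⟩ := hstrict x hx
    rwa [hL.hasFDerivAt.fderiv]
  have hC1 : ContDiffOn ℝ 1 Φ X :=
    contDiffOn_one_of_hasStrictFDerivAt (f' := fderiv ℝ Φ) X.isOpen fun x hx => by
      obtain ⟨L, hL, -⟩ := hstrict x hx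
      rwa [hL.hasFDerivAt.fderiv]
  have hadj : ∀ x ∈ X, (fderiv ℝ Φ x).adjoint ∘L fderiv ℝ Φ x =
      Matrix.toEuclideanCLM (𝕜 := ℝ) (derivGram K x) := fun x hx =>
    adjoint_comp_self_eq_toEuclideanCLM _ fun i j => by
      rw [hgram x hx, derivGram_apply (hKx x hx)]
  have hDinj : ∀ x ∈ X, Function.Injective (fderiv ℝ Φ x) := fun x hx =>
    -- `DΦ^* DΦ` is the operator of the invertible matrix `G`, so `DΦ` has trivial kernel.
    Function.Injective.of_comp (f := (fderiv ℝ Φ x).adjoint) (by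
      rw [← ContinuousLinearMap.coe_comp, hadj x hx]
      exact injective_toEuclideanCLM (hG x hx).isUnit)
  have hcont : ContinuousOn Φ (closure (X : Set (EuclideanSpace ℝ (Fin n)))) :=
    continuousOn_of_inner_eq hΦK (by rw [← closure_prod_eq]; exact hK2.1)
  have hemb : IsEmbedding (fun x : X => Φ x) :=
    isEmbedding_of_injOn_closure hX.isCompact_closure hcont hinj
  have hinjX : InjOn Φ X := hinj.mono hsub
  have hinv := fun x (hx : x ∈ X) => exists_contDiffOn_leftInverse X hC1 hemb hx (hDinj x hx)
  refine ⟨hC1, hadj, ⟨isImmersion_of_injective_fderiv X hC1 hDinj, hemb⟩, fun m F hF => ?_⟩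
  refine ⟨fun x hx => congrArg F (hinjX.leftInvOn_invFunOn hx),
    isC1OnSubmanifold_comp_invFunOn hinjX hinv hF, fun x hx ξ => ?_⟩
  have hFx : DifferentiableAt ℝ F x :=
    (hF.contDiffAt (X.isOpen.mem_nhds hx)).differentiableAt one_ne_zero
  refine hasGradientOnSubmanifold_comp_invFunOn X.isOpen hC1 hinjX hx (hinv x hx)
    ((differentiableAt_const ξ).inner ℝ hFx) ?_
  rw [← ContinuousLinearMap.comp_apply, hadj x hx,
    toEuclideanCLM_apply_inv_apply (hG x hx).isUnit]
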